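/- **Theorem (permutation duality).** Let $n\ge 1$. For an element $x$ of a finite poset $P$ let $D(x)=\{y: y\prec x\}$ be its strict downset. If $P$ is (2+2)-free (no induced subposet is a disjoint union of two 2-element chains), the distinct strict downsets form a chain $\emptyset=D_0\subsetneq D_1\subsetneq\dots\subsetneq D_{\ell(P)}$; the elements $x$ with $D(x)=D_i$ are said to be at level $i$, and $L_i$ is the set of these elements. Let $\ell^\star(P)$ be the least level containing a maximal element. Let $\mathsf{RPosets}_n$ be the set of (unlabelled) (2+2)-free posets with $n$ elements that have a chain of length $\ell(P)$, i.e. a chain $x_0\prec x_1\prec\dots\prec x_{\ell(P)}$. *Posets to sequences.* For a nonempty (2+2)-free poset $P$ and $i=\ell^\star(P)$, let $\mathsf{remove}(P)$ be obtained as follows. If $|L_i|>1$, delete a maximal element at level $i$. If $|L_i|=1$ and $i=\ell(P)$, delete the unique element at level $i$. If $|L_i|=1$ and $i<\ell(P)$, delete all relations $x\prec y$ with $x\in D_{i+1}\setminus D_i$, and then delete the unique element that was at level $i$. With $P^{(n)}=P$ and $P^{(k)}=\mathsf{remove}(P^{(k+1)})$ for $1\le k<n$, put $f_{PA}(P)=(\ell^\star(P^{(1)}),\dots,\ell^\star(P^{(n)}))$.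 *Sequences to permutations.* In a permutation $\pi=\pi_1\cdots\pi_m$ the sites before $\pi_1$ and after $\pi_m$ are active, and the site between $\pi_j$ and $\pi_{j+1}$ is active if $\pi_j=1$ or $\pi_j-1$ is to the left of $\pi_j$. Active sites are labelled $0,1,2,\dots$ from left to right. For $\mathbf a=(a_1,\dots,a_n)$ in the image of $f_{PA}$, start with the permutation $1$ and, for $k=2,\dots,n$, insert $k$ at the active site labelled $a_k$; the result is $f_{AS}(\mathbf a)$. Put $f_{PS}=f_{AS}\circ f_{PA}$. *Permutations.* Let $\mathcal S_n(3\bar152\bar4)$ be the set of permutations $\pi$ of $\{1,\dots,n\}$ such that for all $i<j<k$ with $\pi_k<\pi_i<\pi_j$ there are $l,m$ with $i<l<j<k<m$ and $\pi_l<\pi_k<\pi_i<\pi_m<\pi_j$. Let $\mathrm{rev}(\pi)=(\pi_n,\dots,\pi_1)$ and $\mathrm c(\pi)=(n+1-\pi_1,\dots,n+1-\pi_n)$. Then every $\pi\in\mathcal S_n(3\bar152\bar4)$ has a dual according to $f_{PS}$: there is, up to isomorphism, exactly one $P\in\mathsf{RPosets}_n$ with $f_{PS}(P)=\pi$, and the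 order dual $P^*$ again lies in $\mathsf{RPosets}_n$. The dual permutation $\pi^*:=f_{PS}(P^*)$ is $$\pi^*=\bigl(\mathrm c(\mathrm{rev}(\pi))\bigr)^{-1},$$ the inverse of the complement of the reverse of $\pi$. -/

import Mathlib

/-! ### Finite posets: strict downsets and levels

The strict downset of `x` is `Set.Iio x`.  In a (2+2)-free poset the strict downsets form a chain
`∅ = D 0 ⊂ D 1 ⊂ ... ⊂ D ℓ`; the element `x` lies at level `i` when its strict downset is `D i`. -/

namespace PosetDuality

/-- `ℓ(P)`: the number of distinct nonempty strict downsets. -/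
noncomputable def ell (P : Type*) [PartialOrder P] : ℕ :=
  {D : Set P | D ∈ Set.range (Set.Iio : P → Set P) ∧ D.Nonempty}.ncard

/-- The level of `x`: the number of strict downsets strictly contained in that of `x`, i.e. the
index of `Set.Iio x` in the list of all strict downsets ordered by inclusion. -/
noncomputable def level {P : Type*} [PartialOrder P] (x : P) : ℕ :=
  {D : Set P | D ∈ Set.range (Set.Iio : P → Set P) ∧ D ⊂ Set.Iio x}.ncard

/-- The set `L i` of elements at level `i`. -/
def levelSet (P : Type*) [PartialOrder P] (i : ℕ) : Set P :=
  {x | level x = i}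

/-- The common strict downset `D i` of the elements at level `i`. -/
def levelDownset (P : Type*) [PartialOrder P] (i : ℕ) : Set P :=
  {y | ∃ x ∈ levelSet P i, y < x}

/-- `ℓ⋆(P)`: the least level that contains a maximal element. -/
noncomputable def ellStar (P : Type*) [PartialOrder P] : ℕ :=
  sInf {i | ∃ x : P, IsMax x ∧ level x = i}

/-- No induced subposet is a disjoint union of two 2-element chains. (The order on a sum type is
the one in which elements of different summands are incomparable.) -/
def IsTwoPlusTwoFree (P : Type*) [PartialOrder P] : Prop :=
  IsEmpty (Fin 2 ⊕ Fin 2 ↪o P)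

/-- The (2+2)-free posets with `n` elements that have a chain of length `ℓ(P)`, the length of
a chain being its number of strict steps. -/
def IsRPoset (n : ℕ) (P : FinPartOrd.{0}) : Prop :=
  Fintype.card P = n ∧ IsTwoPlusTwoFree P ∧ ∃ s : LTSeries P, s.length = ell P

/-! ### From posets to ascent sequences -/

/-- The order on `P` with all relations `x < y`, `x ∈ M`, deleted. -/
@[reducible] def cutOrder (P : Type*) [PartialOrder P] (M : Set P) : PartialOrder P where
  le x y := x = y ∨ (x < y ∧ x ∉ M)
  lt x y := x < y ∧ x ∉ M
  le_refl x := Or.inl rfl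
  le_trans x y z := by
    rintro (rfl | ⟨h, hM⟩) (rfl | ⟨h', hM'⟩)
    · exact Or.inl rfl
    · exact Or.inr ⟨h', hM'⟩
    · exact Or.inr ⟨h, hM⟩
    · exact Or.inr ⟨h.trans h', hM⟩
  lt_iff_le_not_ge x y := by
    constructor
    · rintro ⟨h, hM⟩
      refine ⟨Or.inr ⟨h, hM⟩, ?_⟩
      rintro (rfl | ⟨h', -⟩)
      · exact lt_irrefl _ h
      · exact lt_asymm h h'
    · rintro ⟨rfl | h, h'⟩
      · exact absurd (Or.inl rfl) h'
      · exact h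
  le_antisymm x y := by
    rintro (rfl | ⟨h, -⟩) (h' | ⟨h', -⟩)
    · rfl
    · rfl
    · exact h'.symm
    · exact absurd h' (lt_asymm h)

open Classical in
/-- `P` with the element `x` deleted. -/
noncomputable def eraseElt (P : Type) [PartialOrder P] [Fintype P] (x : P) : FinPartOrd.{0} :=
  FinPartOrd.of {y : P // y ≠ x}

open Classical in
/-- The three cases of the reduction step; `x` is a maximal element at level `i = ℓ⋆(P)`. If `x`
is not alone at its level, or if its level is the last one, then `x` is just deleted. Otherwise
the elements of `D (i+1) \ D i` are first made maximal. -/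
noncomputable def removeElt (P : FinPartOrd.{0}) (x : P) : FinPartOrd.{0} :=
  if 1 < (levelSet P (ellStar P)).ncard then
    eraseElt P x
  else if ellStar P = ell P then
    eraseElt P x
  else
    @eraseElt P (cutOrder P (levelDownset P (ellStar P + 1) \ levelDownset P (ellStar P))) _ x

open Classical in
/-- The reduction step: remove a maximal element at level `ℓ⋆(P)`. Such an element exists in
every nonempty finite poset; the empty poset is left unchanged. -/
noncomputable def remove (P : FinPartOrd.{0}) : FinPartOrd.{0} :=
  if h : ∃ x : P, IsMax x ∧ level x = ellStar P then removeElt P h.choose else P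

/-- `(a₁, ..., aₖ)`, where `aₖ = ℓ⋆(P)` and `(a₁, ..., aₖ₋₁)` is obtained in the same way from
the reduced poset. -/
noncomputable def ascSeq : ℕ → FinPartOrd.{0} → List ℕ
  | 0, _ => []
  | k + 1, P => ascSeq k (remove P) ++ [ellStar P]

/-- The map from (2+2)-free posets to ascent sequences. -/
noncomputable def fPA (P : FinPartOrd.{0}) : List ℕ :=
  ascSeq (Fintype.card P) P

/-! ### From ascent sequences to permutations in one-line notation -/

/-- The active sites of the permutation `w = w₁ ... wₘ` from left to right; `j` is the site with
exactly `j` entries before it. The first and the last site are active, and the site after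
`wⱼ`, `0 < j < m`, is active when `wⱼ = 1` or `wⱼ - 1` is to the left of `wⱼ`. -/
def activeSites (w : List ℕ) : List ℕ :=
  (List.range (w.length + 1)).filter fun j =>
    j = 0 ∨ j = w.length ∨ w.getD (j - 1) 0 = 1 ∨ w.getD (j - 1) 0 - 1 ∈ w.take (j - 1)

/-- Insert the next entry at the active site labelled `k`, the labels starting at `0`. -/
def insertNext (w : List ℕ) (k : ℕ) : List ℕ :=
  w.insertIdx ((activeSites w).getD k 0) (w.length + 1)

/-- The map from ascent sequences to permutations. -/
def fAS (a : List ℕ) : List ℕ :=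
  a.foldl insertNext []

/-- `f_PS = f_AS ∘ f_PA`. -/
noncomputable def fPS (P : FinPartOrd.{0}) : List ℕ :=
  fAS (fPA P)

/-! ### Permutations -/

/-- One-line notation `π(1) ... π(n)` with entries in `{1, ..., n}`. -/
def oneLine {n : ℕ} (π : Equiv.Perm (Fin n)) : List ℕ :=
  List.ofFn fun i => (π i : ℕ) + 1

/-- The reverse `(π(n), ..., π(1))`. -/
def rev {n : ℕ} (π : Equiv.Perm (Fin n)) : Equiv.Perm (Fin n) :=
  Fin.revPerm.trans π

/-- The complement `(n + 1 - π(1), ..., n + 1 - π(n))`. -/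
def compl {n : ℕ} (π : Equiv.Perm (Fin n)) : Equiv.Perm (Fin n) :=
  π.trans Fin.revPerm

/-- Avoidance of the barred pattern `3 1̄ 5 2 4̄`: every occurrence of 231 plays the role of 352
in an occurrence of 31524. -/
def AvoidsBarred {n : ℕ} (π : Equiv.Perm (Fin n)) : Prop :=
  ∀ i j k : Fin n, i < j → j < k → π k < π i → π i < π j →
    ∃ l m : Fin n, i < l ∧ l < j ∧ k < m ∧ π l < π k ∧ π i < π m ∧ π m < π j

/-! ### Duality -/

/-- The dual of `s` according to `f` is defined, and it is `t`: up to isomorphism there is exactly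
one `n`-element poset `P` of the restricted class with `f P = s`, its order dual is again in the
class, and `f Pᵒᵈ = t`. -/
def IsDualAccordingTo {S : Type*} (n : ℕ) (f : FinPartOrd.{0} → S) (s t : S) : Prop :=
  (∃ P : FinPartOrd.{0}, IsRPoset n P ∧ f P = s) ∧
  (∀ P Q : FinPartOrd.{0}, IsRPoset n P → IsRPoset n Q → f P = s →
    (f Q = s ↔ Nonempty (P ≃o Q))) ∧
  (∀ P : FinPartOrd.{0}, IsRPoset n P → f P = s →
    IsRPoset n (FinPartOrd.of Pᵒᵈ) ∧ f (FinPartOrd.of Pᵒᵈ) = t)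

end PosetDuality

namespace PosetDuality

/-! A (2+2)-free poset is an interval order. Here `l x` is the level of `x` and `r x` is the last
`i` with `x ∉ D_i`. A chain of length `ℓ(P)` exists exactly when every one-point interval `[k, k]`
occurs. In this class the third case of the reduction never arises: a maximal element alone at its
level would be `[k, k]` with `k` the last level. Hence reduction only deletes intervals, by
decreasing `r` and then increasing `l`, and the ascent sequence lists `l` in the opposite order
(`IntervalRep.ascSeq_eq`). Such a sequence is self-modified, so active sites are the boundaries
between levels (`activeSites_eq`). Therefore `fPS P` lists the labels by increasing `l` and, within
a level, by decreasing label (`IsCoding.fPS_eq`). The permutation determines the intervals: records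
correspond to the first label of each value of `r`, and counting them gives `r` and `l`
(`IsCoding.r_eq`, `IsCoding.l_eq`). For a permutation avoiding the barred pattern the same counts
define a coding (`AvoidsBarred.exists_isCoding`). Duality reflects each interval to `[m - 1 - r, m -
1 - l]`. This interchanges the ordering of labels with the ordering of positions, both reversed,
which gives the inverse of the reverse complement (`IsCoding.dual`). -/

/-- `x ↦ [l x, r x]` represents `P` as an interval order with endpoints in `{0, ..., m - 1}`, and
all one-point intervals occur. -/
structure IntervalRep (P : Type*) [PartialOrder P] (m : ℕ) (l r : P → ℕ) : Prop where
  lt_iff : ∀ x y, x < y ↔ r x < l y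
  le : ∀ x, l x ≤ r x
  lt : ∀ x, r x < m
  diag : ∀ k < m, ∃ x, l x = k ∧ r x = k

/-! ### Levels and maximal elements read off from intervals -/

namespace IntervalRep

variable {P : Type*} [PartialOrder P] {m : ℕ} {l r : P → ℕ}

theorem Iio_eq (h : IntervalRep P m l r) (x : P) : Set.Iio x = {y | r y < l x} :=
  Set.ext fun y => h.lt_iff y x

/-- Since `[k, k]` occurs for each `k < m`, no candidate downset is skipped; this is what makes left
endpoints equal to levels. -/
theorem mem_range_Iio (h : IntervalRep P m l r) (D : Set P) :
    D ∈ Set.range (Set.Iio : P → Set P) ↔ ∃ k < m, {y | r y < k} = D := by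
  constructor
  · rintro ⟨x, rfl⟩
    exact ⟨l x, (h.le x).trans_lt (h.lt x), (h.Iio_eq x).symm⟩
  · rintro ⟨k, hk, rfl⟩
    obtain ⟨x, hx, -⟩ := h.diag k hk
    exact ⟨x, by rw [h.Iio_eq, hx]⟩

theorem downset_ssubset (h : IntervalRep P m l r) {k k' : ℕ} (hk : k < m) (hkk : k < k') :
    {y | r y < k} ⊂ {y | r y < k'} := by
  obtain ⟨x, -, hx⟩ := h.diag k hk
  refine (Set.ssubset_iff_of_subset fun y (hy : r y < k) => hy.trans hkk).2 ⟨x, ?_, ?_⟩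
  · exact hx.trans_lt hkk
  · exact fun hlt : r x < k => hlt.ne hx

theorem downset_injOn (h : IntervalRep P m l r) :
    Set.InjOn (fun k => {y | r y < k}) (Set.Iio m) := by
  intro k hk k' hk' hkk
  rcases lt_trichotomy k k' with h1 | h1 | h1
  · exact absurd hkk (h.downset_ssubset hk h1).ne
  · exact h1
  · exact absurd hkk (h.downset_ssubset hk' h1).ne'

theorem level_eq (h : IntervalRep P m l r) (x : P) : level x = l x := by
  have hlx := (h.le x).trans_lt (h.lt x)
  have : {D : Set P | D ∈ Set.range (Set.Iio : P → Set P) ∧ D ⊂ Set.Iio x} =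
      (fun k => {y | r y < k}) '' (Finset.range (l x) : Set ℕ) := by
    ext D
    simp only [Set.mem_ofPred_eq, h.mem_range_Iio, h.Iio_eq, Set.mem_image, Finset.coe_range,
      Set.mem_Iio]
    constructor
    · rintro ⟨⟨k, hk, rfl⟩, hD⟩
      refine ⟨k, ?_, rfl⟩
      by_contra hcon
      exact hD.2 fun y (hy : r y < l x) => hy.trans_le (not_lt.1 hcon)
    · rintro ⟨k, hk, rfl⟩
      exact ⟨⟨k, hk.trans hlx, rfl⟩, h.downset_ssubset (hk.trans hlx) hk⟩
  rw [level, this, Set.InjOn.ncard_image, Set.ncard_coe_finset, Finset.card_range]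
  refine h.downset_injOn.mono ?_
  intro k hk
  simp at hk ⊢
  omega

theorem ell_eq (h : IntervalRep P m l r) : ell P = m - 1 := by
  have : {D : Set P | D ∈ Set.range (Set.Iio : P → Set P) ∧ D.Nonempty} =
      (fun k => {y | r y < k}) '' (Finset.Ico 1 m : Set ℕ) := by
    ext D
    simp only [Set.mem_ofPred_eq, h.mem_range_Iio, Set.mem_image, Finset.coe_Ico, Set.mem_Ico]
    constructor
    · rintro ⟨⟨k, hk, rfl⟩, y, hy⟩
      exact ⟨k, ⟨Nat.one_le_of_lt hy, hk⟩, rfl⟩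
    · rintro ⟨k, hk, rfl⟩
      obtain ⟨y, -, hy⟩ := h.diag 0 (by omega)
      exact ⟨⟨k, hk.2, rfl⟩, y, hy.trans_lt hk.1⟩
  rw [ell, this, Set.InjOn.ncard_image, Set.ncard_coe_finset, Nat.card_Ico]
  refine h.downset_injOn.mono ?_
  intro k hk
  simp at hk ⊢
  omega

theorem isMax_iff (h : IntervalRep P m l r) (x : P) : IsMax x ↔ r x + 1 = m := by
  have hx := h.lt x
  rw [isMax_iff_forall_not_lt]
  constructor
  · intro hmax
    by_contra hcon
    obtain ⟨y, hy, -⟩ := h.diag (m - 1) (by omega)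
    exact hmax y ((h.lt_iff x y).2 (by omega))
  · intro hr y hxy
    have := (h.lt_iff x y).1 hxy
    have := h.le y
    have := h.lt y
    omega

theorem isTwoPlusTwoFree (h : IntervalRep P m l r) : IsTwoPlusTwoFree P := by
  refine ⟨fun f => ?_⟩
  have h1 : f (Sum.inl 0) < f (Sum.inl 1) := f.lt_iff_lt.2 (by simp)
  have h2 : f (Sum.inr 0) < f (Sum.inr 1) := f.lt_iff_lt.2 (by simp)
  have h3 : ¬ f (Sum.inl 0) < f (Sum.inr 1) := fun h => by simpa using f.lt_iff_lt.1 h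
  have h4 : ¬ f (Sum.inr 0) < f (Sum.inl 1) := fun h => by simpa using f.lt_iff_lt.1 h
  rw [h.lt_iff] at h1 h2 h3 h4
  omega

theorem exists_ltSeries (h : IntervalRep P m l r) [Nonempty P] :
    ∃ s : LTSeries P, s.length = ell P := by
  have hm : 0 < m := Nat.zero_lt_of_lt (h.lt (Classical.arbitrary P))
  choose d hl hr using h.diag
  rw [h.ell_eq]
  refine ⟨⟨m - 1, fun i => d i (by omega), fun i => ?_⟩, rfl⟩
  change d _ _ < d _ _
  rw [h.lt_iff, hl, hr]
  simp

/-- Removing an element with maximal right and, among these, minimal left end. -/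
theorem erase (h : IntervalRep P m l r) (x : P) (hx : r x + 1 = m)
    (hmin : ∀ y, r y + 1 = m → l x ≤ l y) :
    ∃ m', IntervalRep {y : P // y ≠ x} m' (fun y => l y) (fun y => r y) := by
  by_cases hd : ∃ y, y ≠ x ∧ l y = m - 1 ∧ r y = m - 1
  · refine ⟨m, fun y z => h.lt_iff y z, fun y => h.le y, fun y => h.lt y, fun k hk => ?_⟩
    obtain ⟨y, hly, hry⟩ := h.diag k hk
    by_cases hyx : y = x
    · obtain ⟨z, hzx, hz⟩ := hd
      subst hyx
      exact ⟨⟨z, hzx⟩, by dsimp only; omega⟩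
    · exact ⟨⟨y, hyx⟩, hly, hry⟩
  -- Now `x` is the only `[m - 1, m - 1]`. By minimality of `l x` no other interval ends at `m - 1`,
  -- so the range of endpoints shrinks by one.
  · push Not at hd
    obtain ⟨z, hlz, hrz⟩ := h.diag (m - 1) (by omega)
    have hzx : z = x := by
      by_contra hne
      exact hd z hne hlz hrz
    subst hzx
    refine ⟨m - 1, fun y z => h.lt_iff y z, fun y => h.le y, fun y => ?_, fun k hk => ?_⟩
    · have h1 := h.lt y
      have h2 := h.le y
      have h3 := hd y y.2
      have h4 := hmin y
      omega
    · obtain ⟨y, hly, hry⟩ := h.diag k (by omega)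
      exact ⟨⟨y, by rintro rfl; omega⟩, hly, hry⟩

end IntervalRep

/-! ### The canonical interval representation -/

theorem IsTwoPlusTwoFree.Iio_total {P : Type*} [PartialOrder P] (h : IsTwoPlusTwoFree P)
    (x y : P) : Set.Iio x ⊆ Set.Iio y ∨ Set.Iio y ⊆ Set.Iio x := by
  by_contra hcon
  simp only [not_or, Set.not_subset, Set.mem_Iio] at hcon
  obtain ⟨⟨a, hax, hay⟩, b, hby, hbx⟩ := hcon
  have hab : ¬ a ≤ b := fun h => hay (h.trans_lt hby)
  have hba : ¬ b ≤ a := fun h => hbx (h.trans_lt hax)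
  have hay' : ¬ a ≤ y := fun h => h.eq_or_lt.elim (fun h => hba (h ▸ hby.le)) hay
  have hbx' : ¬ b ≤ x := fun h => h.eq_or_lt.elim (fun h => hab (h ▸ hax.le)) hbx
  have hxb : ¬ x ≤ b := fun h => hab (hax.le.trans h)
  have hya : ¬ y ≤ a := fun h => hba (hby.le.trans h)
  have hxy : ¬ x ≤ y := fun h => hay (hax.trans_le h)
  have hyx : ¬ y ≤ x := fun h => hbx (hby.trans_le h)
  refine h.false (OrderEmbedding.ofMapLEIff (Sum.elim ![a, x] ![b, y]) ?_)
  rintro (i | i) (j | j) <;> fin_cases i <;> fin_cases j <;>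
    simp [hax.le, hby.le, hax.not_ge, hby.not_ge, *]

/-- The canonical interval representation. -/
theorem exists_intervalRep {P : Type*} [PartialOrder P] [Finite P] (h : IsTwoPlusTwoFree P)
    (s : LTSeries P) (hs : s.length = ell P) : ∃ m l r, IntervalRep P m l r := by
  set 𝒟 : Set (Set P) := Set.range (Set.Iio : P → Set P) with h𝒟
  have hfin : ∀ 𝒜 : Set (Set P), 𝒜.Finite := fun 𝒜 => Set.toFinite _
  have hcard : 𝒟.ncard ≤ ell P + 1 := by
    have hsub : 𝒟 ⊆ insert ∅ {D | D ∈ 𝒟 ∧ D.Nonempty} := by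
      intro D hD
      rcases D.eq_empty_or_nonempty with rfl | hne
      · exact Or.inl rfl
      · exact Or.inr ⟨hD, hne⟩
    exact (Set.ncard_le_ncard hsub (hfin _)).trans (Set.ncard_insert_le _ _)
  have hpos : ∀ x : P, 0 < {D | D ∈ 𝒟 ∧ x ∉ D}.ncard := fun x =>
    (Set.ncard_pos (hfin _)).2 ⟨Set.Iio x, ⟨x, rfl⟩, lt_irrefl x⟩
  -- In the chain of downsets, `x` is missing from an initial segment `D_0, ..., D_i`; the right
  -- endpoint is `i`, one less than the number of these sets.
  have hlt : ∀ x y : P, x < y ↔ {D | D ∈ 𝒟 ∧ x ∉ D}.ncard - 1 < level y := by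
    intro x y
    have hx := hpos x
    constructor
    · intro hxy
      have : {D | D ∈ 𝒟 ∧ x ∉ D}.ncard ≤ level y := by
        refine Set.ncard_le_ncard ?_ (hfin _)
        rintro D ⟨⟨z, rfl⟩, hxz⟩
        refine ⟨⟨z, rfl⟩, (h.Iio_total z y).elim (fun hzy => ⟨hzy, fun hyz => hxz (hyz hxy)⟩)
          fun hyz => absurd (hyz hxy) hxz⟩
      omega
    · intro hr
      by_contra hxy
      have : insert (Set.Iio y) {D | D ∈ 𝒟 ∧ D ⊂ Set.Iio y} ⊆ {D | D ∈ 𝒟 ∧ x ∉ D} := by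
        rintro D (rfl | ⟨hD, hDy⟩)
        · exact ⟨⟨y, rfl⟩, hxy⟩
        · exact ⟨hD, fun hxD => hxy (hDy.1 hxD)⟩
      have h1 := Set.ncard_le_ncard this (hfin _)
      rw [Set.ncard_insert_of_notMem (fun h => ssubset_irrefl _ h.2) (hfin _)] at h1
      have h2 : level y = {D | D ∈ 𝒟 ∧ D ⊂ Set.Iio y}.ncard := rfl
      omega
  have hle : ∀ x : P, level x ≤ {D | D ∈ 𝒟 ∧ x ∉ D}.ncard - 1 := fun x =>
    not_lt.1 fun hx => lt_irrefl x ((hlt x x).2 hx)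
  refine ⟨ell P + 1, level, fun x => {D | D ∈ 𝒟 ∧ x ∉ D}.ncard - 1, hlt, hle, ?_, ?_⟩
  · intro x
    have h1 := hpos x
    have h2 : {D | D ∈ 𝒟 ∧ x ∉ D}.ncard ≤ 𝒟.ncard :=
      Set.ncard_le_ncard (fun D hD => hD.1) (hfin _)
    omega
  -- A chain of `ℓ(P) + 1` disjoint intervals in `ℓ(P) + 1` points leaves no room: counting from the
  -- bottom bounds the left ends below by `i`, counting from the top bounds the right ends above by
  -- `i`.
  · have hstep : ∀ i (hi : i < s.length), {D | D ∈ 𝒟 ∧ s ⟨i, by omega⟩ ∉ D}.ncard - 1 <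
        level (s ⟨i + 1, by omega⟩) := fun i hi => (hlt _ _).1 (s.step ⟨i, hi⟩)
    have hlow : ∀ i (hi : i < s.length + 1), i ≤ level (s ⟨i, hi⟩) := by
      intro i
      induction i with
      | zero => intro _; exact Nat.zero_le _
      | succ i ih =>
        intro hi
        have := ih (by omega)
        have := hle (s ⟨i, by omega⟩)
        have := hstep i (by omega)
        omega
    have hup : ∀ d (hd : d < s.length + 1),
        {D | D ∈ 𝒟 ∧ s ⟨s.length - d, by omega⟩ ∉ D}.ncard - 1 ≤ s.length - d := by
      intro d
      induction d with
      | zero =>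
        intro hd
        have h2 : {D | D ∈ 𝒟 ∧ s ⟨s.length - 0, by omega⟩ ∉ D}.ncard ≤ 𝒟.ncard :=
          Set.ncard_le_ncard (fun D hD => hD.1) (hfin _)
        omega
      | succ d ih =>
        intro hd
        have h1 := ih (by omega)
        have h2 := hle (s ⟨s.length - d, by omega⟩)
        have h3 := hstep (s.length - (d + 1)) (by omega)
        simp only [show s.length - (d + 1) + 1 = s.length - d by omega] at h3
        omega
    intro k hk
    refine ⟨s ⟨k, by omega⟩, ?_⟩
    have h1 := hlow k (by omega)
    have h2 := hle (s ⟨k, by omega⟩)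
    have h3 := hup (s.length - k) (by omega)
    simp only [show s.length - (s.length - k) = k by omega] at h3
    dsimp only
    omega

/-! ### The reduction step and the ascent sequence -/

section Remove

variable {P : FinPartOrd.{0}} {m : ℕ} {l r : P → ℕ}

theorem IntervalRep.exists_remove_eq (h : IntervalRep P m l r) [Nonempty P] :
    ∃ x : P, r x + 1 = m ∧ l x = ellStar P ∧ (∀ y, r y + 1 = m → l x ≤ l y) ∧
      remove P = eraseElt P x := by
  have hm : 0 < m := Nat.zero_lt_of_lt (h.lt (Classical.arbitrary P))
  have hne : {i | ∃ x : P, IsMax x ∧ level x = i}.Nonempty := by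
    obtain ⟨x, -, hx⟩ := h.diag (m - 1) (by omega)
    exact ⟨level x, x, (h.isMax_iff x).2 (by omega), rfl⟩
  have hex : ∃ x : P, IsMax x ∧ level x = ellStar P := Nat.sInf_mem hne
  have hspec := hex.choose_spec
  have hrm : remove P = removeElt P hex.choose := by rw [remove, dif_pos hex]
  rw [hrm]
  generalize hex.choose = x at hspec
  rw [h.isMax_iff, h.level_eq] at hspec
  refine ⟨x, hspec.1, hspec.2, ?_, ?_⟩
  · intro y hy
    rw [hspec.2]
    exact Nat.sInf_le ⟨y, (h.isMax_iff y).2 hy, h.level_eq y⟩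
  · rw [removeElt]
    split_ifs with h1 h2
    · rfl
    · rfl
    -- The interval `[l x, l x]` lies at the same level as `x`, and it differs from `x` because `l x
    -- < m - 1 = r x`.
    · exfalso
      refine h1 ((Set.one_lt_ncard (Set.toFinite _)).2 ?_)
      have hx := h.le x
      rw [h.ell_eq] at h2
      obtain ⟨z, hlz, hrz⟩ := h.diag (l x) (by omega)
      refine ⟨x, (h.level_eq x).trans hspec.2, z, (h.level_eq z).trans (by omega), ?_⟩
      rintro rfl
      omega

theorem map_univ_subtype_ne {α β : Type*} [Fintype α] (x : α) [Fintype {y // y ≠ x}]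
    (f : α → β) : (Finset.univ : Finset α).val.map f =
      f x ::ₘ (Finset.univ : Finset {y // y ≠ x}).val.map fun y : {y // y ≠ x} => f y := by
  classical
  have : (Finset.univ : Finset α).val =
      x ::ₘ (Finset.univ : Finset {y // y ≠ x}).val.map Subtype.val := by
    have h1 : (Finset.univ : Finset α) = Finset.cons x
        ((Finset.univ : Finset {y // y ≠ x}).map (Function.Embedding.subtype _)) (by simp) := by
      ext y
      by_cases hy : y = x <;> simp [hy]
    rw [h1]
    rfl
  rw [this, Multiset.map_cons, Multiset.map_map]
  simp only [Function.comp_def]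

/-- Pairs `(l, r)` sorted by increasing `r` and then decreasing `l`. -/
def RightOrder (p q : ℕ × ℕ) : Prop :=
  p.2 < q.2 ∨ (p.2 = q.2 ∧ q.1 ≤ p.1)

/-- The deleted element has the interval that comes last in `RightOrder`, so each reduction strips
the end of the sorted list. Working with the multiset of intervals makes the choice among equal
intervals irrelevant. -/
theorem IntervalRep.ascSeq_eq (L : List (ℕ × ℕ)) (P : FinPartOrd.{0}) (m : ℕ) (l r : P → ℕ)
    (h : IntervalRep P m l r)
    (hL : (Finset.univ : Finset P).val.map (fun x => (l x, r x)) = (L : Multiset (ℕ × ℕ)))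
    (hs : L.Pairwise RightOrder) : ascSeq L.length P = L.map Prod.fst := by
  induction L using List.reverseRecOn generalizing P m l r with
  | nil => rfl
  | append_singleton L p ih =>
    have hmem : ∀ q : ℕ × ℕ, q ∈ L ++ [p] ↔ ∃ x : P, (l x, r x) = q := by
      intro q
      rw [← Multiset.mem_coe, ← hL]
      simp
    obtain ⟨x₀, hx₀⟩ := (hmem p).1 (by simp)
    have : Nonempty P := ⟨x₀⟩
    obtain ⟨x, hrx, hlx, hmin, hrem⟩ := h.exists_remove_eq
    rw [List.pairwise_append] at hs
    have hlast : ∀ q ∈ L ++ [p], RightOrder q p := by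
      intro q hq
      rcases List.mem_append.1 hq with hq | hq
      · exact hs.2.2 q hq p (by simp)
      · rw [List.mem_singleton.1 hq]; exact Or.inr ⟨rfl, le_rfl⟩
    have hp : p = (l x, r x) := by
      have h1 := hlast (l x, r x) ((hmem _).2 ⟨x, rfl⟩)
      have h2 := h.lt x₀
      have h3 := hmin x₀
      subst hx₀
      simp only [RightOrder] at h1
      ext <;> dsimp only <;> omega
    rw [List.length_append, List.length_singleton, ascSeq, List.map_append, hrem]
    obtain ⟨m', h'⟩ := h.erase x hrx hmin
    rw [ih (eraseElt P x) m' (fun y => l y.1) (fun y => r y.1) h' ?_ hs.1]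
    · simp [hp, hlx]
    · have hL' : (Finset.univ : Finset P).val.map (fun x => (l x, r x)) =
          (l x, r x) ::ₘ (Finset.univ : Finset (eraseElt P x)).val.map
            (fun y => (l y.1, r y.1)) :=
        @map_univ_subtype_ne _ _ _ x (eraseElt P x).isFintype _
      rw [hL', hp, ← Multiset.coe_add, Multiset.add_comm, Multiset.coe_singleton,
        Multiset.singleton_add] at hL
      exact (Multiset.cons_inj_right _).1 hL

end Remove

/-! ### Self-modified sequences and active sites -/

/-- `b` is a self-modified ascent sequence with `M k` distinct entries among the first `k`: every
entry is at most its predecessor or is the least value not used yet. -/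
structure IsSelfModified (n : ℕ) (b M : ℕ → ℕ) : Prop where
  zero : M 0 = 0
  step : ∀ k < n, (b k = M k ∧ M (k + 1) = M k + 1) ∨
    (0 < k ∧ b k ≤ b (k - 1) ∧ M (k + 1) = M k)

namespace IsSelfModified

variable {n : ℕ} {b M : ℕ → ℕ}

theorem lt_of_lt (h : IsSelfModified n b M) {k : ℕ} (hk : k ≤ n) :
    ∀ j < k, b j < M k := by
  induction k with
  | zero => intro j hj; omega
  | succ k ih =>
    intro j hj
    have ih := ih (by omega)
    rcases h.step k (by omega) with ⟨h1, h2⟩ | ⟨h0, h1, h2⟩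
    · rcases Nat.lt_succ_iff_lt_or_eq.1 hj with h3 | rfl
      · have := ih j h3; omega
      · omega
    · rcases Nat.lt_succ_iff_lt_or_eq.1 hj with h3 | rfl
      · have := ih j h3; omega
      · have := ih (j - 1) (by omega); omega

theorem exists_eq (h : IsSelfModified n b M) {k : ℕ} (hk : k ≤ n) :
    ∀ i < M k, ∃ j < k, b j = i := by
  induction k with
  | zero => intro i hi; rw [h.zero] at hi; omega
  | succ k ih =>
    intro i hi
    have ih := ih (by omega)
    rcases h.step k (by omega) with ⟨h1, h2⟩ | ⟨h0, h1, h2⟩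
    · rcases Nat.lt_succ_iff_lt_or_eq.1 (h2 ▸ hi : i < M k + 1) with h3 | rfl
      · obtain ⟨j, hj, rfl⟩ := ih i h3
        exact ⟨j, by omega, rfl⟩
      · exact ⟨k, by omega, h1⟩
    · obtain ⟨j, hj, rfl⟩ := ih i (by omega)
      exact ⟨j, by omega, rfl⟩

end IsSelfModified

/-- The order in which the labels occur in the permutation: by increasing level, and by decreasing
label within a level. The label `v` is at level `b (v - 1)`. -/
def LevelOrder (b : ℕ → ℕ) (u v : ℕ) : Prop :=
  b (u - 1) < b (v - 1) ∨ (b (u - 1) = b (v - 1) ∧ v < u)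

theorem eq_filter_append_filter {α : Type*} (p : α → Bool) (w : List α)
    (h : w.Pairwise fun u v => p v = true → p u = true) :
    w = w.filter p ++ w.filter fun x => !p x := by
  induction w with
  | nil => rfl
  | cons x w ih =>
    rw [List.pairwise_cons] at h
    have ih := ih h.2
    by_cases hx : p x = true
    · simp only [List.filter_cons, hx, if_true, List.cons_append, Bool.not_true]
      simpa using ih
    · have hw : ∀ y ∈ w, ¬ p y = true := fun y hy hpy => hx (h.1 y hy hpy)
      rw [List.filter_eq_nil_iff.2 (by simpa [hx] using hw), List.nil_append,
        List.filter_eq_self.2 (by simpa [hx] using hw)]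

section

variable {n : ℕ} {b M : ℕ → ℕ} {k : ℕ} {w : List ℕ}

/-- The number of entries of `w` below level `i`. -/
def levelOffset (b : ℕ → ℕ) (w : List ℕ) (i : ℕ) : ℕ :=
  (w.filter fun v => b (v - 1) < i).length

theorem split_at_level (hs : w.Pairwise (LevelOrder b)) (i : ℕ) :
    w = (w.filter fun v => b (v - 1) < i) ++ w.filter fun v => !decide (b (v - 1) < i) := by
  refine eq_filter_append_filter _ w (hs.imp ?_)
  rintro u v (h | ⟨h, -⟩) <;> simp only [decide_eq_true_eq] <;> omega

theorem mem_activeSites_append {A B : List ℕ} {v : ℕ} (hB : B ≠ []) :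
    (A ++ [v]).length ∈ activeSites (A ++ [v] ++ B) ↔ v = 1 ∨ v - 1 ∈ A := by
  simp [activeSites, hB]

/-- An inner site after `v` is a level boundary iff `v` is the least label of its level. That means
`v` opened the level, and then `v - 1` is at a lower level, to the left. Otherwise `v - 1` is at the
same or a higher level, to the right of `v`. -/
theorem mem_activeSites_iff (h : IsSelfModified n b M) (hk : k ≤ n)
    (hw : w.Perm (List.range' 1 k)) (hs : w.Pairwise (LevelOrder b)) (j : ℕ) :
    j ∈ activeSites w ↔ ∃ i ≤ M k, levelOffset b w i = j := by
  have hmem : ∀ v, v ∈ w ↔ 1 ≤ v ∧ v ≤ k := fun v => by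
    rw [hw.mem_iff, List.mem_range'_1]; omega
  constructor
  · intro hj
    have hjw : j ≤ w.length := by
      have := List.mem_range.1 (List.mem_of_mem_filter hj); omega
    rcases Nat.eq_zero_or_pos j with rfl | hj0
    · exact ⟨0, by omega, by simp [levelOffset]⟩
    rcases hjw.eq_or_lt with rfl | hjlt
    · refine ⟨M k, le_rfl, ?_⟩
      rw [levelOffset, List.filter_eq_self.2]
      intro v hv
      have := (hmem v).1 hv
      simpa using h.lt_of_lt hk (v - 1) (by omega)
    obtain ⟨A, v, B, rfl, hA⟩ : ∃ A v B, w = A ++ [v] ++ B ∧ (A ++ [v]).length = j := by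
      refine ⟨w.take (j - 1), w[j - 1], w.drop j, ?_, by simp; omega⟩
      have : w.take (j - 1) ++ [w[j - 1]] = w.take j := by
        rw [List.take_append_getElem]; congr 1; omega
      rw [this, List.take_append_drop]
    have hB : B ≠ [] := by
      rintro rfl
      simp at hA hjlt; omega
    rw [← hA, mem_activeSites_append hB] at hj
    have hvk := (hmem v).1 (by simp)
    refine ⟨b (v - 1) + 1, h.lt_of_lt hk (v - 1) (by omega), ?_⟩
    simp only [List.append_assoc, List.pairwise_append, List.pairwise_cons, List.singleton_append, List.mem_cons] at hs
    have h1 : ∀ u ∈ A ++ [v], decide (b (u - 1) < b (v - 1) + 1) = true := by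
      intro u hu
      rw [decide_eq_true_eq]
      rcases List.mem_append.1 hu with hu | hu
      · rcases hs.2.2 u hu v (Or.inl rfl) with h | ⟨h, -⟩ <;> omega
      · rw [List.mem_singleton.1 hu]; omega
    have h2 : ∀ u ∈ B, ¬ decide (b (u - 1) < b (v - 1) + 1) = true := by
      intro u hu
      rw [decide_eq_true_eq]
      have huk := (hmem u).1 (by simp [hu])
      rcases hs.2.1.1 u hu with h3 | ⟨h3, h4⟩
      · omega
      rcases hj with rfl | hj
      · omega
      rcases hs.2.2 _ hj v (Or.inl rfl) with h5 | ⟨-, h5⟩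
      · rcases h.step (v - 1) (by omega) with ⟨h6, -⟩ | ⟨-, h6, -⟩
        · have := h.lt_of_lt (k := v - 1) (by omega) (u - 1) (by omega)
          omega
        · omega
      · omega
    rw [levelOffset, List.filter_append, List.filter_eq_self.2 h1, List.filter_eq_nil_iff.2 h2,
      List.append_nil, hA]
  · rintro ⟨i, hi, rfl⟩
    rw [levelOffset]
    have hsplit := split_at_level hs i
    have hAi : ∀ u ∈ w.filter (fun v => decide (b (v - 1) < i)), u ∈ w ∧ b (u - 1) < i :=
      fun u hu => by simpa using hu
    have hAi' : ∀ u ∈ w, b (u - 1) < i → u ∈ w.filter (fun v => decide (b (v - 1) < i)) :=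
      fun u hu hu' => by simpa using ⟨hu, hu'⟩
    generalize w.filter (fun v => decide (b (v - 1) < i)) = A at hsplit hAi hAi' ⊢
    generalize w.filter (fun v => !decide (b (v - 1) < i)) = B at hsplit
    rcases List.eq_nil_or_concat A with rfl | ⟨A, v, rfl⟩
    · simp [activeSites]
    rcases eq_or_ne B [] with rfl | hB
    · rw [hsplit]; simp [activeSites]
    rw [List.concat_eq_append] at *
    rw [hsplit, mem_activeSites_append hB]
    rw [hsplit, List.append_assoc, List.pairwise_append] at hs
    have hAv : ∀ u ∈ A, LevelOrder b u v := fun u hu => hs.2.2 u hu v (by simp)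
    have hv := hAi v (by simp)
    have hvk := (hmem v).1 hv.1
    rw [or_iff_not_imp_left]
    intro hv1
    -- The entries up to the boundary are exactly those of level below `i`, so smaller labels at
    -- levels up to that of `v` precede `v`.
    have key : ∀ u, 1 ≤ u → u < v → b (u - 1) ≤ b (v - 1) → u ∈ A := by
      intro u hu1 huv hle
      have := hAi' u ((hmem u).2 (by omega)) (by omega)
      rcases List.mem_append.1 this with h | h
      · exact h
      · rw [List.mem_singleton] at h; omega
    rcases h.step (v - 1) (by omega) with ⟨h6, -⟩ | ⟨-, h6, -⟩
    · exact key _ (by omega) (by omega)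
        (h6 ▸ (h.lt_of_lt (by omega) (v - 1 - 1) (by omega)).le)
    -- An earlier label on the level of `v` would precede `v`, against the decreasing order within a
    -- level.
    · exfalso
      have h7 := h.lt_of_lt (k := v - 1) (by omega) (v - 1 - 1) (by omega)
      obtain ⟨u, hu, hub⟩ := h.exists_eq (k := v - 1) (by omega) (b (v - 1)) (by omega)
      have := hAv (u + 1) (key (u + 1) (by omega) (by omega) (by simp [hub]))
      rw [LevelOrder, Nat.add_sub_cancel] at this
      omega

theorem insertIdx_length_append {α : Type*} (A B : List α) (x : α) :
    (A ++ B).insertIdx A.length x = A ++ x :: B := by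
  induction A with
  | nil => simp
  | cons y A ih => simpa using ih

theorem levelOffset_lt (h : IsSelfModified n b M) (hk : k ≤ n)
    (hw : w.Perm (List.range' 1 k)) {i i' : ℕ} (hi : i < i') (hi' : i' ≤ M k) :
    levelOffset b w i < levelOffset b w i' := by
  obtain ⟨j, hj, rfl⟩ := h.exists_eq hk i (by omega)
  rw [levelOffset, levelOffset, ← List.countP_eq_length_filter, ← List.countP_eq_length_filter,
    hw.countP_eq, hw.countP_eq, List.countP_eq_length_filter, List.countP_eq_length_filter]
  have hnd : (List.range' 1 k).Nodup := List.nodup_range'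
  rw [← List.toFinset_card_of_nodup (hnd.filter _), ← List.toFinset_card_of_nodup (hnd.filter _)]
  apply Finset.card_lt_card
  rw [Finset.ssubset_iff_of_subset]
  · refine ⟨j + 1, ?_, ?_⟩
    · simp; omega
    · simp
  · intro x; simp; omega

theorem activeSites_eq (h : IsSelfModified n b M) (hk : k ≤ n)
    (hw : w.Perm (List.range' 1 k)) (hs : w.Pairwise (LevelOrder b)) :
    activeSites w = (List.range (M k + 1)).map (levelOffset b w) := by
  have h1 : (activeSites w).Pairwise (· < ·) := (List.pairwise_lt_range).filter _
  have h2 : ((List.range (M k + 1)).map (levelOffset b w)).Pairwise (· < ·) := by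
    rw [List.pairwise_map]
    refine (List.pairwise_lt_range (n := M k + 1)).imp_of_mem ?_
    intro i i' hi hi' hlt
    exact levelOffset_lt h hk hw hlt (by simpa [Nat.lt_succ_iff] using hi')
  refine List.Perm.eq_of_pairwise (le := (· < ·)) (fun a b _ _ h h' => absurd h' (lt_asymm h))
    h1 h2 ?_
  rw [List.perm_ext_iff_of_nodup (h1.imp ne_of_lt) (h2.imp ne_of_lt)]
  intro j
  rw [mem_activeSites_iff h hk hw hs]
  simp

/-- The new label exceeds all others, so it belongs at the front of its level, which is the site
with label `b k`. -/
theorem insertNext_perm_pairwise (h : IsSelfModified n b M) (hk : k < n)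
    (hw : w.Perm (List.range' 1 k)) (hs : w.Pairwise (LevelOrder b)) :
    (insertNext w (b k)).Perm (List.range' 1 (k + 1)) ∧
      (insertNext w (b k)).Pairwise (LevelOrder b) := by
  have hmem : ∀ v, v ∈ w ↔ 1 ≤ v ∧ v ≤ k := fun v => by
    rw [hw.mem_iff, List.mem_range'_1]; omega
  have hlen : w.length = k := by rw [hw.length_eq, List.length_range']
  have hbk : b k < M k + 1 := by
    rcases h.step k hk with ⟨h6, -⟩ | ⟨h0, h6, -⟩
    · omega
    · have := h.lt_of_lt hk.le (k - 1) (by omega); omega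
  have hsite : (activeSites w).getD (b k) 0 = levelOffset b w (b k) := by
    rw [activeSites_eq h hk.le hw hs, List.getD_eq_getElem _ _ (by simpa using hbk)]
    simp
  have hsplit := split_at_level hs (b k)
  have hins : insertNext w (b k) = (w.filter fun v => b (v - 1) < b k) ++
      (k + 1) :: w.filter fun v => !decide (b (v - 1) < b k) := by
    rw [insertNext, hsite, hlen, levelOffset]
    generalize (w.filter fun v => decide (b (v - 1) < b k)) = A at *
    generalize (w.filter fun v => !decide (b (v - 1) < b k)) = B at *
    rw [hsplit, insertIdx_length_append]
  rw [hins]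
  constructor
  · refine List.perm_middle.trans ?_
    rw [← hsplit, List.range'_concat]
    refine (List.perm_append_singleton _ _).symm.trans ?_
    rw [show 1 + 1 * k = k + 1 by omega]
    exact hw.append_right _
  · rw [hsplit, List.pairwise_append] at hs
    rw [List.pairwise_append, List.pairwise_cons]
    refine ⟨hs.1, ⟨?_, hs.2.1⟩, ?_⟩
    · intro v hv
      simp only [List.mem_filter, hmem] at hv
      simp [LevelOrder] at hv ⊢
      omega
    · intro u hu v hv
      rcases List.mem_cons.1 hv with rfl | hv
      · simp only [List.mem_filter, hmem] at hu
        simp [LevelOrder] at hu ⊢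
        omega
      · exact hs.2.2 u hu v hv

theorem fAS_perm_pairwise (h : IsSelfModified n b M) (hk : k ≤ n) :
    (fAS ((List.range k).map b)).Perm (List.range' 1 k) ∧
      (fAS ((List.range k).map b)).Pairwise (LevelOrder b) := by
  induction k with
  | zero => simp [fAS]
  | succ k ih =>
    obtain ⟨h1, h2⟩ := ih (by omega)
    have : fAS ((List.range (k + 1)).map b) = insertNext (fAS ((List.range k).map b)) (b k) := by
      simp [fAS, List.range_succ]
    rw [this]
    exact insertNext_perm_pairwise h hk h1 h2

end

/-! ### Codings: recovering intervals from a permutation -/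

/-- The labels `0, ..., n - 1` carry intervals `[l i, r i]` in `{0, ..., m - 1}`, all `[k, k]` occur,
the labels are sorted by increasing `r` and then decreasing `l`, and `π` lists them by increasing
`l` and then decreasing label. -/
structure IsCoding {n : ℕ} (π : Equiv.Perm (Fin n)) (m : ℕ) (l r : Fin n → ℕ) : Prop where
  le : ∀ i, l i ≤ r i
  lt : ∀ i, r i < m
  diag : ∀ k < m, ∃ i, l i = k ∧ r i = k
  label : ∀ i j, i < j → r i < r j ∨ (r i = r j ∧ l j ≤ l i)
  position : ∀ i j, π.symm i < π.symm j → l i < l j ∨ (l i = l j ∧ j < i)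

/-- The labels `v` such that `v` is the least label or `v - 1` is to the left of `v` in `π`. -/
def IsRecord {n : ℕ} (π : Equiv.Perm (Fin n)) (v : Fin n) : Prop :=
  ∀ u : Fin n, (u : ℕ) + 1 = v → π.symm u < π.symm v

open Classical in
/-- The number of records up to `v`, minus one. -/
noncomputable def recordR {n : ℕ} (π : Equiv.Perm (Fin n)) (v : Fin n) : ℕ :=
  (Finset.univ.filter fun u => IsRecord π u ∧ u ≤ v).card - 1

open Classical in
/-- The number of records to the left of `v`. -/
noncomputable def recordL {n : ℕ} (π : Equiv.Perm (Fin n)) (v : Fin n) : ℕ :=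
  (Finset.univ.filter fun u => IsRecord π u ∧ π.symm u < π.symm v).card

namespace IsCoding

variable {n m : ℕ} {π : Equiv.Perm (Fin n)} {l r : Fin n → ℕ}

theorem r_mono (h : IsCoding π m l r) {i j : Fin n} (hij : i ≤ j) : r i ≤ r j := by
  rcases hij.eq_or_lt with rfl | hij
  · rfl
  · rcases h.label i j hij with h | h <;> omega

/-- If `v - 1` is left of `v` then `l (v - 1) < l v`, which the label order allows only when `r`
increases. The first label in a block of constant `r` is a one-point interval, because `l` decreases
weakly along the block. -/
theorem isRecord_iff (h : IsCoding π m l r) (v : Fin n) :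
    IsRecord π v ↔ l v = r v ∧ ∀ u < v, r u < r v := by
  constructor
  · intro hv
    have hlt : ∀ u < v, r u < r v := by
      intro u huv
      have hv0 : 0 < (v : ℕ) := lt_of_le_of_lt (Nat.zero_le _) huv
      let w : Fin n := ⟨v - 1, by omega⟩
      have huw : u ≤ w := Fin.le_def.2 (by have := Fin.lt_def.1 huv; simp only [w]; omega)
      have hwv : w < v := Fin.lt_def.2 (by simp only [w]; omega)
      have h1 := h.position w v (hv w (by simp only [w]; omega))
      have h2 := h.label w v hwv
      have h3 := h.r_mono huw
      have h4 : ¬ v < w := not_lt.2 hwv.le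
      have : ¬ (l w = l v ∧ v < w) := fun h => h4 h.2
      omega
    refine ⟨?_, hlt⟩
    obtain ⟨j, hjl, hjr⟩ := h.diag (r v) (h.lt v)
    rcases lt_trichotomy j v with hj | rfl | hj
    · have := hlt j hj; omega
    · omega
    · have := h.label v j hj; have := h.le v; omega
  · rintro ⟨h1, h2⟩ u hu
    have huv : u < v := Fin.lt_def.2 (by omega)
    have h3 := h2 u huv
    have h4 := h.le u
    by_contra hcon
    rcases (not_lt.1 hcon).eq_or_lt with h5 | h5
    · exact huv.ne' (π.symm.injective h5)
    · have := h.position v u h5; omega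

theorem exists_isRecord (h : IsCoding π m l r) (k : ℕ) (hk : k < m) :
    ∃ v, IsRecord π v ∧ r v = k := by
  obtain ⟨j, hjl, hjr⟩ := h.diag k hk
  obtain ⟨v, hv, hmin⟩ := WellFounded.has_min (wellFounded_lt (α := Fin n)) {i | r i = k} ⟨j, hjr⟩
  refine ⟨v, (h.isRecord_iff v).2 ⟨?_, ?_⟩, hv⟩
  · have hvk : r v = k := hv
    rcases (not_lt.1 (hmin j hjr)).eq_or_lt with rfl | hvj
    · omega
    · have := h.label v j hvj; have := h.le v; omega
  · intro u hu
    have := h.r_mono hu.le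
    have hvk : r v = k := hv
    have : r u ≠ k := fun hr => hmin u hr hu
    omega

-- On records, `r` is a bijection onto `{0, ..., m - 1}`; both record counts reduce to this.
open Classical in
theorem card_records (h : IsCoding π m l r) (p : Fin n → Prop) (c : ℕ) (hc : c ≤ m)
    (hp : ∀ u, IsRecord π u → (p u ↔ r u < c)) :
    (Finset.univ.filter fun u => IsRecord π u ∧ p u).card = c := by
  rw [← Finset.card_range c]
  refine Finset.card_bij (fun u _ => r u) ?_ ?_ ?_
  · intro u hu
    simp only [Finset.mem_filter, Finset.mem_univ, true_and] at hu
    exact Finset.mem_range.2 ((hp u hu.1).1 hu.2)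
  · intro u hu v hv huv
    simp only [Finset.mem_filter, Finset.mem_univ, true_and] at hu hv
    rcases lt_trichotomy u v with h1 | h1 | h1
    · have := ((h.isRecord_iff v).1 hv.1).2 u h1; omega
    · exact h1
    · have := ((h.isRecord_iff u).1 hu.1).2 v h1; omega
  · intro k hk
    rw [Finset.mem_range] at hk
    obtain ⟨v, hv, rfl⟩ := h.exists_isRecord k (by omega)
    exact ⟨v, by simpa using ⟨hv, (hp v hv).2 hk⟩, rfl⟩

theorem r_eq (h : IsCoding π m l r) : r = recordR π := by
  classical
  funext v
  have key : (Finset.univ.filter fun u => IsRecord π u ∧ u ≤ v).card = r v + 1 := by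
    convert h.card_records (· ≤ v) (r v + 1) (h.lt v) ?_
    intro u hu
    constructor
    · intro huv
      have := h.r_mono huv; omega
    · intro hr
      by_contra huv
      have := ((h.isRecord_iff u).1 hu).2 v (not_le.1 huv)
      omega
  rw [recordR, key, Nat.add_sub_cancel]

theorem l_eq (h : IsCoding π m l r) : l = recordL π := by
  classical
  funext v
  rw [recordL]
  symm
  convert h.card_records (fun u => π.symm u < π.symm v) (l v) ((h.le v).trans (h.lt v).le) ?_
  intro u hu
  obtain ⟨h1, h2⟩ := (h.isRecord_iff u).1 hu
  constructor
  · intro huv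
    rcases h.position u v huv with h3 | ⟨h3, h4⟩
    · omega
    · have := h2 v h4; have := h.le v; omega
  · intro hr
    by_contra hcon
    rcases (not_lt.1 hcon).eq_or_lt with h5 | h5
    · have := π.symm.injective h5; subst this; omega
    · have := h.position v u h5; omega

end IsCoding

/-! ### Codings of pattern-avoiding permutations -/

section Avoiding

variable {n : ℕ} {π : Equiv.Perm (Fin n)}

/-- A record to the left of `v` is smaller than `v`. -/
theorem AvoidsBarred.not_lt_of_isRecord (hπ : AvoidsBarred π) {u v : Fin n} (hu : IsRecord π u)
    (huv : π.symm u < π.symm v) : u < v := by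
  by_contra hcon
  have hne : u ≠ v := by rintro rfl; exact lt_irrefl _ huv
  have hvu : v < u := lt_of_le_of_ne (not_lt.1 hcon) hne.symm
  let w : Fin n := ⟨u - 1, by omega⟩
  have hwu : (w : ℕ) + 1 = u := by have := Fin.lt_def.1 hvu; simp only [w]; omega
  have hpos := hu w hwu
  have hwv : w ≠ v := fun h => lt_asymm hpos (h ▸ huv)
  have hvw : v < w := by
    have := Fin.val_ne_of_ne hwv
    rw [Fin.lt_def] at hvu ⊢
    omega
  -- In the 231 formed by `u - 1, u, v`, the barred 4 would need a value strictly between `u - 1`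
  -- and `u`.
  obtain ⟨a, b, -, -, -, -, h1, h2⟩ := hπ (π.symm w) (π.symm u) (π.symm v) hpos huv
    (by simpa using hvw) (by rw [π.apply_symm_apply, π.apply_symm_apply, Fin.lt_def]; omega)
  rw [π.apply_symm_apply, Fin.lt_def] at h1 h2
  omega

theorem AvoidsBarred.apply_succ_lt (hπ : AvoidsBarred π) {p q : Fin n} (hpq : (p : ℕ) + 1 = q)
    (hp : ¬ IsRecord π (π p)) : π q < π p := by
  simp only [IsRecord, not_forall, not_lt] at hp
  obtain ⟨u, hu, hle⟩ := hp
  rw [π.symm_apply_apply] at hle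
  have hpu : p ≠ π.symm u := by
    rintro rfl
    rw [π.apply_symm_apply] at hu; omega
  by_contra hcon
  have hne : π p ≠ π q := fun h => by have := π.injective h; subst this; omega
  have hlt : π p < π q := lt_of_le_of_ne (not_lt.1 hcon) hne
  have hqu : q ≠ π.symm u := by
    rintro rfl
    rw [π.apply_symm_apply, Fin.lt_def] at hlt; omega
  have hqu' : q < π.symm u := by
    have := Fin.val_ne_of_ne hpu
    have := Fin.val_ne_of_ne hqu
    rw [Fin.lt_def]
    rw [Fin.le_def] at hle
    omega
  -- Here `u = π p - 1` completes a 231, and the barred 1 would need a position strictly between the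
  -- neighbours `p` and `q`.
  obtain ⟨a, b, h1, h2, -⟩ := hπ p q (π.symm u) (Fin.lt_def.2 (by omega)) hqu'
    (by rw [π.apply_symm_apply, Fin.lt_def]; omega) hlt
  rw [Fin.lt_def] at h1 h2
  omega

theorem symm_le_of_no_record {u v : Fin n} (huv : u ≤ v)
    (h : ∀ w, u < w → w ≤ v → ¬ IsRecord π w) : π.symm v ≤ π.symm u := by
  obtain ⟨d, hd⟩ : ∃ d, (v : ℕ) = u + d := ⟨v - u, by rw [Fin.le_def] at huv; omega⟩
  induction d generalizing v with
  | zero => rw [show v = u from Fin.ext (by omega)]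
  | succ d ih =>
    let w : Fin n := ⟨u + d, by omega⟩
    have h1 : π.symm w ≤ π.symm u := by
      refine ih (Fin.le_def.2 (by simp only [w]; omega)) ?_ rfl
      intro x hx hxw
      refine h x hx (Fin.le_def.2 ?_)
      have := Fin.le_def.1 hxw
      simp only [w] at this; omega
    refine le_trans ?_ h1
    have h2 := h v (Fin.lt_def.2 (by omega)) le_rfl
    simp only [IsRecord, not_forall, not_lt] at h2
    obtain ⟨x, hx, hle⟩ := h2
    rwa [show w = x from Fin.ext (by simp only [w]; omega)]

theorem AvoidsBarred.apply_lt_of_no_record (hπ : AvoidsBarred π) {p q : Fin n} (hpq : p < q)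
    (h : ∀ x, p ≤ x → x < q → ¬ IsRecord π (π x)) : π q < π p := by
  obtain ⟨d, hd⟩ : ∃ d, (q : ℕ) = p + d + 1 := ⟨q - p - 1, by rw [Fin.lt_def] at hpq; omega⟩
  induction d generalizing q with
  | zero => exact hπ.apply_succ_lt (by omega) (h p le_rfl hpq)
  | succ d ih =>
    let w : Fin n := ⟨p + d + 1, by omega⟩
    have hwq : w < q := Fin.lt_def.2 (by simp only [w]; omega)
    have hpw : p < w := Fin.lt_def.2 (by simp only [w]; omega)
    refine lt_trans (hπ.apply_succ_lt (by simp only [w]; omega) (h w hpw.le hwq)) ?_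
    exact ih hpw (fun x hx hxw => h x hx (hxw.trans hwq)) rfl

theorem exists_last_record (v : Fin n) :
    ∃ u ≤ v, IsRecord π u ∧ ∀ w, u < w → w ≤ v → ¬ IsRecord π w := by
  classical
  have hne : (Finset.univ.filter fun u => IsRecord π u ∧ u ≤ v).Nonempty := by
    refine ⟨⟨0, by have := v.2; omega⟩, Finset.mem_filter.2 ⟨Finset.mem_univ _, ?_, ?_⟩⟩
    · intro u hu
      exact absurd hu (Nat.succ_ne_zero _)
    · exact Fin.le_def.2 (Nat.zero_le _)
  have hmem := Finset.max'_mem _ hne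
  simp only [Finset.mem_filter, Finset.mem_univ, true_and] at hmem
  refine ⟨_, hmem.2, hmem.1, fun w hw hwv hrec => ?_⟩
  exact absurd (Finset.le_max' _ w (by simpa using ⟨hrec, hwv⟩)) (not_le.2 hw)

open Classical in
theorem AvoidsBarred.exists_isCoding (hπ : AvoidsBarred π) :
    ∃ m l r, IsCoding π m l r := by
  have hpos : ∀ v, 0 < (Finset.univ.filter fun u => IsRecord π u ∧ u ≤ v).card := by
    intro v
    obtain ⟨u, huv, hu, -⟩ := exists_last_record (π := π) v
    exact Finset.card_pos.2 ⟨u, by simpa using ⟨hu, huv⟩⟩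
  -- Records appear in increasing order, and for a record `v` the records below it are exactly those
  -- to its left; only `v` itself makes the two counts differ, hence the minus one in `recordR`.
  have hrec : ∀ v, IsRecord π v → recordL π v = recordR π v := by
    intro v hv
    have : (Finset.univ.filter fun u => IsRecord π u ∧ u ≤ v) =
        insert v (Finset.univ.filter fun u => IsRecord π u ∧ π.symm u < π.symm v) := by
      ext u
      simp only [Finset.mem_filter, Finset.mem_univ, true_and, Finset.mem_insert]
      constructor
      · rintro ⟨hu, huv⟩
        rcases huv.eq_or_lt with rfl | huv
        · exact Or.inl rfl
        refine Or.inr ⟨hu, ?_⟩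
        by_contra hcon
        rcases (not_lt.1 hcon).eq_or_lt with h1 | h1
        · exact huv.ne' (π.symm.injective h1)
        · exact lt_asymm huv (hπ.not_lt_of_isRecord hv h1)
      · rintro (rfl | ⟨hu, huv⟩)
        · exact ⟨hv, le_rfl⟩
        · exact ⟨hu, (hπ.not_lt_of_isRecord hu huv).le⟩
    rw [recordR, this, Finset.card_insert_of_notMem (by simp), Nat.add_sub_cancel, recordL]
  have hLmono : ∀ u v, π.symm u ≤ π.symm v → recordL π u ≤ recordL π v := by
    intro u v huv
    refine Finset.card_le_card fun w => ?_
    simp only [Finset.mem_filter, Finset.mem_univ, true_and]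
    exact fun hw => ⟨hw.1, hw.2.trans_le huv⟩
  have hRmono : ∀ u v, u ≤ v → recordR π u ≤ recordR π v := by
    intro u v huv
    refine Nat.sub_le_sub_right (Finset.card_le_card fun w => ?_) 1
    simp only [Finset.mem_filter, Finset.mem_univ, true_and]
    exact fun hw => ⟨hw.1, hw.2.trans huv⟩
  have hRlt : ∀ u v, u < v → IsRecord π v → recordR π u < recordR π v := by
    intro u v huv hv
    have h1 := hpos u
    have : (Finset.univ.filter fun w => IsRecord π w ∧ w ≤ u).card <
        (Finset.univ.filter fun w => IsRecord π w ∧ w ≤ v).card := by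
      refine Finset.card_lt_card ((Finset.ssubset_iff_of_subset ?_).2 ⟨v, ?_, ?_⟩)
      · intro w
        simp only [Finset.mem_filter, Finset.mem_univ, true_and]
        exact fun hw => ⟨hw.1, hw.2.trans huv.le⟩
      · simpa using hv
      · simp [huv]
    rw [recordR, recordR]
    omega
  have hLlt : ∀ u v, π.symm u < π.symm v → IsRecord π u → recordL π u < recordL π v := by
    intro u v huv hu
    refine Finset.card_lt_card ((Finset.ssubset_iff_of_subset ?_).2 ⟨u, ?_, ?_⟩)
    · intro w
      simp only [Finset.mem_filter, Finset.mem_univ, true_and]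
      exact fun hw => ⟨hw.1, hw.2.trans huv⟩
    · simpa using ⟨hu, huv⟩
    · simp
  refine ⟨(Finset.univ.filter fun u => IsRecord π u).card, recordL π, recordR π,
    ?_, ?_, ?_, ?_, ?_⟩
  · intro v
    obtain ⟨u, huv, hu, hno⟩ := exists_last_record (π := π) v
    -- With `u` the last record up to `v`, the labels from `u` to `v` move steadily left, so `v` is
    -- weakly left of `u`.
    calc recordL π v ≤ recordL π u := hLmono _ _ (symm_le_of_no_record huv hno)
      _ = recordR π u := hrec u hu
      _ ≤ recordR π v := hRmono _ _ huv
  · intro v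
    have h1 := hpos v
    have h2 : (Finset.univ.filter fun u => IsRecord π u ∧ u ≤ v).card ≤
        (Finset.univ.filter fun u => IsRecord π u).card :=
      Finset.card_le_card fun w => by simpa using fun hw _ => hw
    rw [recordR]
    omega
  · have hinj : Set.InjOn (recordR π) (Finset.univ.filter fun u => IsRecord π u) := by
      intro u hu v hv huv
      have hu : IsRecord π u := by simpa using hu
      have hv : IsRecord π v := by simpa using hv
      rcases lt_trichotomy u v with h | h | h
      · exact absurd huv (hRlt u v h hv).ne
      · exact h
      · exact absurd huv (hRlt v u h hu).ne'
    have himg : (Finset.univ.filter fun u => IsRecord π u).image (recordR π) =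
        Finset.range (Finset.univ.filter fun u => IsRecord π u).card := by
      refine Finset.eq_of_subset_of_card_le ?_ ?_
      · intro k hk
        obtain ⟨v, hv, rfl⟩ := Finset.mem_image.1 hk
        have h1 := hpos v
        have h2 : (Finset.univ.filter fun u => IsRecord π u ∧ u ≤ v).card ≤
            (Finset.univ.filter fun u => IsRecord π u).card :=
          Finset.card_le_card fun w => by simpa using fun hw _ => hw
        rw [Finset.mem_range, recordR]
        omega
      · rw [Finset.card_range, Finset.card_image_of_injOn hinj]
    intro k hk
    rw [← Finset.mem_range, ← himg] at hk
    obtain ⟨v, hv, rfl⟩ := Finset.mem_image.1 hk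
    exact ⟨v, hrec v (by simpa using hv), rfl⟩
  · intro i j hij
    rcases (hRmono i j hij.le).lt_or_eq with h | h
    · exact Or.inl h
    refine Or.inr ⟨h, hLmono _ _ (symm_le_of_no_record hij.le fun w hw hwj hr => ?_)⟩
    have := hRlt i w hw hr
    have := hRmono w j hwj
    omega
  · intro i j hij
    rcases (hLmono i j hij.le).lt_or_eq with h | h
    · exact Or.inl h
    refine Or.inr ⟨h, ?_⟩
    -- Equal `recordL` means no record sits from the position of `i` up to just before that of `j`,
    -- and entries decrease along such a stretch.
    have := hπ.apply_lt_of_no_record hij fun x hx hxj hr => ?_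
    · simpa using this
    · have h1 := hLmono i (π x) (by simpa using hx)
      have h2 := hLlt (π x) j (by simpa using hxj) hr
      omega

end Avoiding

theorem oneLine_injective {n : ℕ} : Function.Injective (oneLine (n := n)) := by
  intro π σ h
  refine Equiv.ext fun i => Fin.ext ?_
  have := congrFun (List.ofFn_injective h) i
  simpa using this

/-! ### From codings to `fPS` and to the dual -/

namespace IsCoding

variable {n m : ℕ} {π : Equiv.Perm (Fin n)} {l r : Fin n → ℕ}

theorem intervalRep (h : IsCoding π m l r) {P : Type*} [PartialOrder P] (e : Fin n ≃ P)
    (hlt : ∀ i j, e i < e j ↔ r i < l j) : IntervalRep P m (l ∘ e.symm) (r ∘ e.symm) where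
  lt_iff x y := by simpa using hlt (e.symm x) (e.symm y)
  le x := h.le _
  lt x := h.lt _
  diag k hk := by
    obtain ⟨i, hi⟩ := h.diag k hk
    exact ⟨e i, by simpa using hi⟩

theorem isRPoset (h : IsCoding π m l r) (hn : 1 ≤ n) (P : FinPartOrd.{0}) (e : Fin n ≃ P)
    (hlt : ∀ i j, e i < e j ↔ r i < l j) : IsRPoset n P := by
  have : Nonempty P := ⟨e ⟨0, hn⟩⟩
  have hrep := h.intervalRep e hlt
  exact ⟨by rw [← Fintype.card_congr e, Fintype.card_fin], hrep.isTwoPlusTwoFree,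
    hrep.exists_ltSeries⟩

/-- Along the labels `r` rises by at most one, since every `[k, k]` has a label. A rise starts with
the new one-point interval; otherwise `l` does not increase. -/
theorem isSelfModified (h : IsCoding π m l r) :
    IsSelfModified n (fun j => if hj : j < n then l ⟨j, hj⟩ else 0)
      (fun k => if hk : k - 1 < n ∧ k ≠ 0 then r ⟨k - 1, hk.1⟩ + 1 else 0) where
  zero := by simp
  step k hk := by
    rcases Nat.eq_zero_or_pos k with rfl | hk0
    · left
      have h1 := h.le ⟨0, hk⟩
      have h2 := h.lt ⟨0, hk⟩
      obtain ⟨j, -, hj⟩ := h.diag 0 (by omega)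
      have h3 := h.r_mono (i := ⟨0, hk⟩) (j := j) (Fin.le_def.2 (Nat.zero_le _))
      simp [hk]
      omega
    have hk1 : k - 1 < n := by omega
    have hlab := h.label ⟨k - 1, hk1⟩ ⟨k, hk⟩ (Fin.lt_def.2 (by simp only; omega))
    simp only [hk, hk1, dif_pos, Nat.add_sub_cancel, ne_eq, hk0.ne', not_false_eq_true, and_self,
      Nat.succ_ne_zero]
    rcases hlab with hlab | ⟨hr, hl⟩
    · left
      have h1 := h.lt ⟨k, hk⟩
      have h2 := h.le ⟨k, hk⟩
      obtain ⟨j, hjl, hjr⟩ := h.diag (r ⟨k - 1, hk1⟩ + 1) (by omega)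
      have hj : (⟨k, hk⟩ : Fin n) ≤ j := by
        by_contra hcon
        have := h.r_mono (i := j) (j := ⟨k - 1, hk1⟩)
          (Fin.le_def.2 (by have := Fin.lt_def.1 (not_le.1 hcon); simp only at this ⊢; omega))
        omega
      have h3 := h.r_mono hj
      rcases hj.eq_or_lt with rfl | hj
      · omega
      · have := h.label _ _ hj
        omega
    · right
      omega

theorem fPS_eq (h : IsCoding π m l r) (P : FinPartOrd.{0}) (e : Fin n ≃ P)
    (hlt : ∀ i j, e i < e j ↔ r i < l j) : fPS P = oneLine π := by
  have hcard : Fintype.card P = n := by rw [← Fintype.card_congr e, Fintype.card_fin]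
  have hasc : ascSeq n P = (List.ofFn fun i => (l i, r i)).map Prod.fst := by
    have := IntervalRep.ascSeq_eq (List.ofFn fun i => (l i, r i)) P m _ _ (h.intervalRep e hlt) ?_ ?_
    · rwa [List.length_ofFn] at this
    · have h1 : (Finset.univ : Finset P) = Finset.univ.map e.toEmbedding := by simp
      rw [h1, Finset.map_val, Multiset.map_map, List.ofFn_eq_map, ← Multiset.map_coe]
      simp [List.ofFn_eq_map, Fin.univ_val_map]
    · rw [List.pairwise_ofFn]
      exact h.label
  obtain ⟨h1, h2⟩ := fAS_perm_pairwise h.isSelfModified le_rfl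
  have hb : (List.range n).map (fun j => if hj : j < n then l ⟨j, hj⟩ else 0) =
      (List.ofFn fun i => (l i, r i)).map Prod.fst := by
    refine List.ext_getElem (by simp) fun i hi _ => ?_
    have : i < n := by simpa using hi
    simp [this]
  have hf : fPS P = fAS (ascSeq n P) := by rw [fPS, fPA, hcard]
  rw [hb, ← hasc, ← hf] at h1 h2
  -- Both lists arrange the labels `1, ..., n` in the same antisymmetric order, so they coincide.
  refine List.Perm.eq_of_pairwise (le := LevelOrder _) ?_ h2 ?_ ?_
  · intro u v _ _ huv hvu
    simp only [LevelOrder] at huv hvu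
    omega
  · rw [oneLine, List.pairwise_ofFn]
    intro i j hij
    have := h.position (π i) (π j) (by simpa using hij)
    simpa [LevelOrder] using this
  · refine h1.trans ?_
    rw [List.perm_ext_iff_of_nodup List.nodup_range']
    · intro v
      rw [List.mem_range'_1, oneLine, List.mem_ofFn]
      constructor
      · intro hv
        exact ⟨π.symm ⟨v - 1, by omega⟩, by rw [π.apply_symm_apply]; dsimp only; omega⟩
      · rintro ⟨i, rfl⟩
        omega
    · rw [oneLine, List.nodup_ofFn]
      intro i j hij
      exact π.injective (Fin.ext (by simpa using hij))

/-- Reversing the intervals exchanges positions and labels. -/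
theorem dual (h : IsCoding π m l r) :
    IsCoding (compl (rev π))⁻¹ m (fun i => m - 1 - r (π i.rev)) (fun i => m - 1 - l (π i.rev)) where
  le i := by
    have := h.le (π i.rev)
    omega
  lt i := by
    have := h.lt (π i.rev)
    omega
  diag k hk := by
    obtain ⟨j, hl, hr⟩ := h.diag (m - 1 - k) (by omega)
    refine ⟨(π.symm j).rev, ?_⟩
    rw [Fin.rev_rev, π.apply_symm_apply]
    omega
  label i j hij := by
    have h1 := h.position (π j.rev) (π i.rev) (by simpa using hij)
    have h2 := h.lt (π i.rev)
    have h3 := h.le (π i.rev)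
    have h4 := h.lt (π j.rev)
    have h5 := h.le (π j.rev)
    rcases h1 with h1 | ⟨h1, h6⟩
    · left; omega
    · have := h.r_mono h6.le
      right; omega
  position i j hij := by
    -- The dual label `i` is the element at position `i.rev` of `π`, and the dual position of that
    -- element is the reverse of its old label.
    have hij' : π j.rev < π i.rev := by
      have h0 : ∀ a, (compl (rev π))⁻¹.symm a = (π a.rev).rev := fun a => rfl
      simpa [h0] using hij
    have h1 := h.label _ _ hij'
    have h2 := h.lt (π i.rev)
    have h4 := h.lt (π j.rev)
    rcases h1 with h1 | ⟨h1, h5⟩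
    · left; omega
    refine Or.inr ⟨by omega, ?_⟩
    by_contra hcon
    have hne : i ≠ j := by rintro rfl; exact lt_irrefl _ hij'
    have hlt : i < j := lt_of_le_of_ne (not_lt.1 hcon) hne
    rcases h.position (π j.rev) (π i.rev) (by simpa using hlt) with h6 | ⟨-, h6⟩
    · omega
    · exact lt_asymm h6 hij'

end IsCoding

/-! ### Codings of posets and posets of codings -/

/-- Elements of an interval order can be labelled and listed in a coding. -/
theorem IntervalRep.exists_isCoding {n m : ℕ} {P : Type*} [PartialOrder P] [Fintype P]
    {l r : P → ℕ} (h : IntervalRep P m l r) (hn : Fintype.card P = n) :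
    ∃ (e : Fin n ≃ P) (π : Equiv.Perm (Fin n)), IsCoding π m (l ∘ e) (r ∘ e) := by
  let e₀ : Fin n ≃ P := (Fintype.equivFinOfCardEq hn).symm
  let key : Fin n → ℕ ×ₗ ℕᵒᵈ := fun i => toLex (r (e₀ i), OrderDual.toDual (l (e₀ i)))
  let e : Fin n ≃ P := (Tuple.sort key).trans e₀
  let key' : Fin n → ℕ ×ₗ (Fin n)ᵒᵈ := fun i => toLex (l (e i), OrderDual.toDual i)
  refine ⟨e, Tuple.sort key', fun i => h.le _, fun i => h.lt _, fun k hk => ?_, fun i j hij => ?_,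
    fun i j hij => ?_⟩
  · obtain ⟨x, hx⟩ := h.diag k hk
    exact ⟨e.symm x, by simpa using hx⟩
  · have := Tuple.monotone_sort key hij.le
    simp only [key, Function.comp_apply, Prod.Lex.toLex_le_toLex,
      OrderDual.toDual_le_toDual] at this
    exact this
  · have h1 := Tuple.monotone_sort key' hij.le
    have hne : i ≠ j := by rintro rfl; exact lt_irrefl _ hij
    simp only [key', Function.comp_apply, Equiv.apply_symm_apply, Prod.Lex.toLex_le_toLex,
      OrderDual.toDual_le_toDual] at h1
    exact h1.imp_right fun h => ⟨h.1, lt_of_le_of_ne h.2 hne.symm⟩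

theorem IsRPoset.exists_isCoding {n : ℕ} {P : FinPartOrd.{0}} (h : IsRPoset n P) :
    ∃ (e : Fin n ≃ P) (π : Equiv.Perm (Fin n)) (m : ℕ) (l r : Fin n → ℕ),
      IsCoding π m l r ∧ (∀ i j, e i < e j ↔ r i < l j) ∧ fPS P = oneLine π := by
  obtain ⟨hcard, hfree, s, hs⟩ := h
  obtain ⟨m, l, r, hrep⟩ := exists_intervalRep hfree s hs
  obtain ⟨e, π, hc⟩ := hrep.exists_isCoding hcard
  have hlt : ∀ i j, e i < e j ↔ (r ∘ e) i < (l ∘ e) j := fun i j => hrep.lt_iff _ _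
  exact ⟨e, π, m, _, _, hc, hlt, hc.fPS_eq P e hlt⟩

/-- The interval order of the intervals `[l i, r i]`. -/
@[reducible] def intervalOrder {n : ℕ} (l r : Fin n → ℕ) (h : ∀ i, l i ≤ r i) :
    PartialOrder (Fin n) where
  le i j := i = j ∨ r i < l j
  lt i j := r i < l j
  le_refl i := Or.inl rfl
  le_trans i j k := by
    rintro (rfl | hij) (rfl | hjk)
    · exact Or.inl rfl
    · exact Or.inr hjk
    · exact Or.inr hij
    · exact Or.inr (by have := h j; omega)
  lt_iff_le_not_ge i j := by
    have h1 := h i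
    have h2 := h j
    constructor
    · intro hij
      refine ⟨Or.inr hij, ?_⟩
      rintro (rfl | hji) <;> omega
    · rintro ⟨rfl | hij, hji⟩
      · exact absurd (Or.inl rfl) hji
      · exact hij
  le_antisymm i j := by
    have h1 := h i
    have h2 := h j
    rintro (rfl | hij) (hji | hji)
    · rfl
    · rfl
    · exact hji.symm
    · omega

theorem exists_equiv_intervalOrder {n : ℕ} (l r : Fin n → ℕ) (h : ∀ i, l i ≤ r i) :
    ∃ (P : FinPartOrd.{0}) (e : Fin n ≃ P), ∀ i j, e i < e j ↔ r i < l j :=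
  ⟨@FinPartOrd.of (Fin n) (intervalOrder l r h) _, Equiv.refl _, fun _ _ => Iff.rfl⟩

theorem nonempty_orderIso_of_lt_iff {P Q : Type*} [PartialOrder P] [PartialOrder Q]
    (e : P ≃ Q) (h : ∀ x y, e x < e y ↔ x < y) : Nonempty (P ≃o Q) :=
  ⟨⟨e, fun {x y} => by rw [le_iff_lt_or_eq, le_iff_lt_or_eq, h, e.injective.eq_iff]⟩⟩

end PosetDuality

open PosetDuality in
theorem mainTheorem3 (n : ℕ) (hn : 1 ≤ n) (π : Equiv.Perm (Fin n))
    (hπ : PosetDuality.AvoidsBarred π) :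
    PosetDuality.IsDualAccordingTo n PosetDuality.fPS (PosetDuality.oneLine π)
      (PosetDuality.oneLine (PosetDuality.compl (PosetDuality.rev π))⁻¹) := by
  refine ⟨?_, ?_, ?_⟩
  · obtain ⟨m, l, r, h⟩ := hπ.exists_isCoding
    obtain ⟨P, e, hlt⟩ := exists_equiv_intervalOrder l r h.le
    exact ⟨P, h.isRPoset hn P e hlt, h.fPS_eq P e hlt⟩
  · intro P Q hP hQ hPπ
    obtain ⟨e, σ, m, l, r, h, hlt, hσ⟩ := hP.exists_isCoding
    obtain rfl : σ = π := oneLine_injective (hσ.symm.trans hPπ)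
    constructor
    · intro hQπ
      obtain ⟨e', σ', m', l', r', h', hlt', hσ'⟩ := hQ.exists_isCoding
      obtain rfl : σ' = σ := oneLine_injective (hσ'.symm.trans hQπ)
      -- Matching equal labels is an isomorphism, because both pairs of endpoint functions are the
      -- record counts of the same permutation.
      refine nonempty_orderIso_of_lt_iff (e.symm.trans e') fun x y => ?_
      have := hlt (e.symm x) (e.symm y)
      rw [e.apply_symm_apply, e.apply_symm_apply, h.r_eq, h.l_eq] at this
      rw [this, Equiv.trans_apply, Equiv.trans_apply, hlt', h'.r_eq, h'.l_eq]
    · rintro ⟨φ⟩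
      refine h.fPS_eq Q (e.trans φ.toEquiv) fun i j => ?_
      rw [← hlt]
      exact φ.lt_iff_lt
  · intro P hP hPπ
    obtain ⟨e, σ, m, l, r, h, hlt, hσ⟩ := hP.exists_isCoding
    obtain rfl : σ = π := oneLine_injective (hσ.symm.trans hPπ)
    let e' : Fin n ≃ FinPartOrd.of Pᵒᵈ :=
      (Fin.revPerm.trans σ).trans (e.trans OrderDual.toDual)
    have hlt' : ∀ i j, e' i < e' j ↔ m - 1 - l (σ i.rev) < m - 1 - r (σ j.rev) := by
      intro i j
      have h1 : e' i < e' j ↔ e (σ j.rev) < e (σ i.rev) := Iff.rfl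
      rw [h1, hlt]
      have := h.lt (σ i.rev)
      have := h.le (σ i.rev)
      have := h.lt (σ j.rev)
      omega
    exact ⟨h.dual.isRPoset hn _ e' hlt', h.dual.fPS_eq _ e' hlt'⟩
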